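/- Let $A\in\mathbb{R}^{n\times n}$, let $\omega>0$, and let $P:\mathbb{R}\to\mathbb{R}^{n\times n}$ be $2\pi/\omega$-periodic (for example, with $2\pi/\omega$ its smallest period), square-integrable over a period, and of zero mean, $\int_0^{2\pi/\omega}P(t)\,dt=0$. Assume that $A$ is diagonalizable over $\mathbb{C}$ and that all its complex eigenvalues have the same real part, so that every eigenvalue is of the form $\lambda+\sqrt{-1}\,\mu_i$ with one common $\lambda\in\mathbb R$. Assume that there is no nonzero integer $l$ with $|\mu_i\pm\mu_j|=l\omega$ for some choice of sign and some (possibly equal) $i,j$. Then: (i) the effective matrix vanishes: $B:=\lim_{T\to\infty}\frac1T\int_0^T e^{-A\tau}P(\tau)e^{A\tau}\,d\tau$ exists and equals $0$; (ii) for all $K>0$ and $\epsilon_0>0$ there is a constant $C>0$, depending only on $A,P,\omega,K,\epsilon_0$ (in particular not on $t$, $\epsilon$ or the solution), such that for every $0<\epsilon\le\epsilon_0$ and every (Carathéodory) solution $x:[0,K/\epsilon]\to\mathbb{R}^n$ of $\dot x=Ax+\epsilon P(t)x$, $$x(t)=e^{At}\bigl(x(0)+E(t,\epsilon)\bigr),\qquad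 \|E(t,\epsilon)\|\le C\,\epsilon\,e^{\epsilon^2Ct}\,\|x(0)\|\qquad\text{for } 0\le t\le K/\epsilon,$$ where $\|\cdot\|$ is the Euclidean norm. -/

import Mathlib

open MeasureTheory Filter Topology

/-- `x` solves `x' = A x + ε P(t) x + f(t)` on `[0, T]` in the sense of Carathéodory (`P` is only
square-integrable, so the equation can hold only for almost every `t`): `x` is continuous, the
right-hand side is integrable along `x`, and `x` is the integral of it. -/
def IsSolutionOn {n : ℕ} (A : Matrix (Fin n) (Fin n) ℝ) (ε : ℝ)
    (P : ℝ → Matrix (Fin n) (Fin n) ℝ) (f : ℝ → EuclideanSpace ℝ (Fin n)) (T : ℝ)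
    (x : ℝ → EuclideanSpace ℝ (Fin n)) : Prop :=
  ContinuousOn x (Set.Icc 0 T) ∧
  IntervalIntegrable (fun s => Matrix.toEuclideanLin (A + ε • P s) (x s) + f s) volume 0 T ∧
  ∀ t ∈ Set.Icc 0 T,
    x t = x 0 + ∫ s in (0 : ℝ)..t, (Matrix.toEuclideanLin (A + ε • P s) (x s) + f s)

/-- The real matrix `A` is diagonalizable over `ℂ`. -/
def IsComplexDiagonalizable {n : ℕ} (A : Matrix (Fin n) (Fin n) ℝ) : Prop :=
  ∃ (S : Matrix (Fin n) (Fin n) ℂ) (d : Fin n → ℂ), IsUnit S ∧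
    A.map Complex.ofReal * S = S * Matrix.diagonal d

/-- The complex eigenvalues of the real matrix `A`. -/
def complexEigenvalues {n : ℕ} (A : Matrix (Fin n) (Fin n) ℝ) : Set ℂ :=
  spectrum ℂ (A.map Complex.ofReal)

/-- `P` is a periodic matrix-valued function with period `2π/ω`, square-integrable over a period. -/
def IsPeriodicL2 {n : ℕ} (ω : ℝ) (P : ℝ → Matrix (Fin n) (Fin n) ℝ) : Prop :=
  Function.Periodic P (2 * Real.pi / ω) ∧
  ∀ i j, MemLp (fun t => P t i j) 2 (volume.restrict (Set.Ioc 0 (2 * Real.pi / ω)))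

/-- The conjugated perturbation `exp(-At) P(t) exp(At)`. -/
noncomputable def conjPerturbation {n : ℕ} (A : Matrix (Fin n) (Fin n) ℝ)
    (P : ℝ → Matrix (Fin n) (Fin n) ℝ) (t : ℝ) : Matrix (Fin n) (Fin n) ℝ :=
  NormedSpace.exp (-(t • A)) * P t * NormedSpace.exp (t • A)

/-- `B` is the effective matrix: the limit, as `T → ∞`, of the time average over `[0, T]` of
`exp(-At) P(t) exp(At)`. -/
def IsEffectiveMatrix {n : ℕ} (A : Matrix (Fin n) (Fin n) ℝ)
    (P : ℝ → Matrix (Fin n) (Fin n) ℝ) (B : Matrix (Fin n) (Fin n) ℝ) : Prop :=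
  ∀ i j, Tendsto (fun T : ℝ => 1 / T * ∫ τ in (0 : ℝ)..T, conjPerturbation A P τ i j)
    atTop (𝓝 (B i j))

/-! In the moving frame `y = exp(-tA) x` the equation becomes `y' = ε Q(t) y` with `Q = exp(-tA) P
exp(tA)`. In an eigenbasis of `A`, each entry of `Q` is a finite combination of terms `exp(iνt)
p(t)`, where `p` is an entry of `P` and `ν` is a difference of imaginary parts of eigenvalues; the
common real part cancels. Off resonance, and with zero mean when `ν = 0`, each such term has a
bounded primitive (`exists_bound_integral_of_add_period`). So the primitive `R` of `Q` is bounded,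
and its time average tends to 0.

Integration by parts gives `y(t) - y(0) = ε R(t) y(t) - ε² ∫ R Q y`. Since `∫ |Q|` grows at most
linearly, Grönwall bounds `y` by a constant multiple of `y(0)` up to time `K/ε`, and the last
integral is `O(1/ε)`. Both terms are therefore `O(ε)`
(`sum_abs_sub_initial_le_of_bounded_primitive`). As `P` is merely square-integrable, the calculus is
done with absolutely continuous functions. -/

/-! ### Calculus of absolutely continuous functions -/

/-- On `[0, T]` the function `u` is the integral of the integrable function `u'`. -/
def IsPrimitiveOn (T : ℝ) (u u' : ℝ → ℝ) : Prop :=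
  IntervalIntegrable u' volume 0 T ∧ ∀ t ∈ Set.Icc 0 T, u t = u 0 + ∫ s in (0 : ℝ)..t, u' s

theorem AbsolutelyContinuousOnInterval.congr_of_eqOn {f g : ℝ → ℝ} {a b : ℝ}
    (hf : AbsolutelyContinuousOnInterval f a b) (h : Set.EqOn f g (Set.uIcc a b)) :
    AbsolutelyContinuousOnInterval g a b := by
  rw [absolutelyContinuousOnInterval_iff] at hf ⊢
  intro ε hε
  obtain ⟨δ, hδ, H⟩ := hf ε hε
  refine ⟨δ, hδ, fun E hE hEδ => ?_⟩
  refine lt_of_eq_of_lt (Finset.sum_congr rfl fun i hi => ?_) (H E hE hEδ)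
  rw [h (hE.1 i hi).1, h (hE.1 i hi).2]

theorem LipschitzWith.comp_absolutelyContinuousOnInterval {φ f : ℝ → ℝ} {a b : ℝ}
    (hφ : LipschitzWith 1 φ) (hf : AbsolutelyContinuousOnInterval f a b) :
    AbsolutelyContinuousOnInterval (fun x => φ (f x)) a b := by
  rw [absolutelyContinuousOnInterval_iff] at hf ⊢
  intro ε hε
  obtain ⟨δ, hδ, H⟩ := hf ε hε
  refine ⟨δ, hδ, fun E hE hEδ => ?_⟩
  refine lt_of_le_of_lt (Finset.sum_le_sum fun i _ => ?_) (H E hE hEδ)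
  simpa using hφ.dist_le_mul (f (E.2 i).1) (f (E.2 i).2)

/-- A globally Lipschitz substitute for `exp(-x)`, equal to it for `x ≥ 0`. Composition with it
preserves absolute continuity, which supplies the integrating factor in Grönwall's inequality. -/
theorem lipschitzWith_exp_neg_abs : LipschitzWith 1 fun x : ℝ => Real.exp (-|x|) := by
  have key : ∀ x y : ℝ, |x| ≤ |y| → Real.exp (-|x|) - Real.exp (-|y|) ≤ |x - y| := by
    intro x y hxy
    have h1 : Real.exp (-|y|) = Real.exp (-|x|) * Real.exp (|x| - |y|) := by
      rw [← Real.exp_add]; ring_nf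
    have h2 : |x| - |y| + 1 ≤ Real.exp (|x| - |y|) := Real.add_one_le_exp _
    have h3 : Real.exp (-|x|) ≤ 1 := Real.exp_le_one_iff.2 (by simp)
    have h4 : |y| - |x| ≤ |x - y| := by
      rw [abs_sub_comm]; exact abs_sub_abs_le_abs_sub y x
    have h5 := Real.exp_pos (-|x|)
    rw [h1]
    nlinarith
  refine LipschitzWith.of_dist_le_mul fun x y => ?_
  rw [NNReal.coe_one, one_mul, Real.dist_eq, Real.dist_eq, abs_le]
  have hmono : ∀ x y : ℝ, |x| ≤ |y| → Real.exp (-|y|) ≤ Real.exp (-|x|) :=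
    fun x y h => Real.exp_le_exp.2 (by linarith)
  have h0 := abs_nonneg (x - y)
  rcases le_total |x| |y| with h | h
  · exact ⟨by linarith [hmono x y h], key x y h⟩
  · have := key y x h
    rw [abs_sub_comm] at this
    exact ⟨by linarith, by linarith [hmono y x h]⟩

namespace IsPrimitiveOn

variable {T : ℝ} {u u' v v' : ℝ → ℝ}

theorem mono (h : IsPrimitiveOn T u u') {t : ℝ} (ht : t ∈ Set.Icc 0 T) : IsPrimitiveOn t u u' := by
  refine ⟨h.1.mono_set ?_, fun s hs => h.2 s ⟨hs.1, hs.2.trans ht.2⟩⟩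
  rw [Set.uIcc_of_le ht.1, Set.uIcc_of_le (ht.1.trans ht.2)]
  exact Set.Icc_subset_Icc le_rfl ht.2

theorem absolutelyContinuousOnInterval (hT : 0 ≤ T) (h : IsPrimitiveOn T u u') :
    AbsolutelyContinuousOnInterval u 0 T := by
  have h1 := h.1.absolutelyContinuousOnInterval_intervalIntegral (c := 0) (by simp)
  have h2 : AbsolutelyContinuousOnInterval (fun _ : ℝ => u 0) 0 T :=
    (contDiff_const.contDiffOn).absolutelyContinuousOnInterval
  refine (h2.add h1).congr_of_eqOn fun t ht => ?_
  rw [Set.uIcc_of_le hT] at ht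
  simp [h.2 t ht]

theorem continuousOn (hT : 0 ≤ T) (h : IsPrimitiveOn T u u') : ContinuousOn u (Set.uIcc 0 T) :=
  (h.absolutelyContinuousOnInterval hT).continuousOn

theorem ae_hasDerivAt (hT : 0 ≤ T) (h : IsPrimitiveOn T u u') :
    ∀ᵐ s, s ∈ Set.uIoc 0 T → HasDerivAt u (u' s) s := by
  -- Nothing is known about `u` to the right of `T`, so this point is discarded.
  have hne : ∀ᵐ s : ℝ, s ≠ T := by simp [ae_iff]
  filter_upwards [h.1.ae_hasDerivAt_integral, hne] with s hs hsT hmem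
  rw [Set.uIoc_of_le hT] at hmem
  have hd := (hs (by rw [Set.uIcc_of_le hT]; exact ⟨hmem.1.le, hmem.2⟩) 0 (by simp)).const_add (u 0)
  refine hd.congr_of_eventuallyEq ?_
  filter_upwards [Ioo_mem_nhds hmem.1 (lt_of_le_of_ne hmem.2 hsT)] with r hr
  exact h.2 r ⟨hr.1.le, hr.2.le⟩

theorem congr (hT : 0 ≤ T) (h : IsPrimitiveOn T u u') (hu : ∀ t ∈ Set.Icc 0 T, v t = u t)
    (hu' : ∀ t ∈ Set.Icc 0 T, v' t = u' t) : IsPrimitiveOn T v v' := by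
  have heq : ∀ t ∈ Set.Icc 0 T, Set.EqOn v' u' (Set.uIcc 0 t) := fun t ht s hs => by
    rw [Set.uIcc_of_le ht.1] at hs
    exact hu' s ⟨hs.1, hs.2.trans ht.2⟩
  refine ⟨h.1.congr fun s hs => ?_, fun t ht => ?_⟩
  · exact (heq T ⟨hT, le_rfl⟩ (Set.uIoc_subset_uIcc hs)).symm
  · rw [hu t ht, hu 0 ⟨le_rfl, hT⟩, h.2 t ht, intervalIntegral.integral_congr (heq t ht)]

/-- Integration by parts for absolutely continuous functions. -/
theorem mul (hT : 0 ≤ T) (hu : IsPrimitiveOn T u u') (hv : IsPrimitiveOn T v v') :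
    IsPrimitiveOn T (fun t => u t * v t) (fun t => u' t * v t + u t * v' t) := by
  refine ⟨(hu.1.mul_continuousOn (hv.continuousOn hT)).add
    (hv.1.continuousOn_mul (hu.continuousOn hT)), fun t ht => ?_⟩
  have hut := hu.mono ht
  have hvt := hv.mono ht
  have h := (hut.absolutelyContinuousOnInterval ht.1).integral_deriv_mul_eq_sub
    (hvt.absolutelyContinuousOnInterval ht.1)
  rw [← sub_eq_iff_eq_add', ← h]
  refine intervalIntegral.integral_congr_ae ?_
  filter_upwards [hut.ae_hasDerivAt ht.1, hvt.ae_hasDerivAt ht.1] with s h1 h2 hs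
  rw [(h1 hs).deriv, (h2 hs).deriv]

theorem sum {ι : Type*} (F : Finset ι) {u u' : ι → ℝ → ℝ}
    (h : ∀ i ∈ F, IsPrimitiveOn T (u i) (u' i)) :
    IsPrimitiveOn T (fun t => ∑ i ∈ F, u i t) (fun t => ∑ i ∈ F, u' i t) := by
  have hint : IntervalIntegrable (fun t => ∑ i ∈ F, u' i t) volume 0 T := by
    have := IntervalIntegrable.sum F (f := u') fun i hi => (h i hi).1
    rwa [Finset.sum_fn] at this
  refine ⟨hint, fun t ht => ?_⟩
  rw [intervalIntegral.integral_finsetSum fun i hi => ((h i hi).mono ht).1,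
    ← Finset.sum_add_distrib]
  exact Finset.sum_congr rfl fun i hi => (h i hi).2 t ht

end IsPrimitiveOn

/-! ### Grönwall's inequality -/

/-- Grönwall's inequality in integral form, with an integrable coefficient. -/
theorem le_mul_exp_integral_of_le_add_integral {T a : ℝ} {g s : ℝ → ℝ}
    (hg : IntervalIntegrable g volume 0 T) (hg0 : ∀ t, 0 ≤ g t)
    (hs : ContinuousOn s (Set.uIcc 0 T))
    (h : ∀ t ∈ Set.Icc 0 T, s t ≤ a + ∫ r in (0 : ℝ)..t, g r * s r) :
    ∀ t ∈ Set.Icc 0 T, s t ≤ a * Real.exp (∫ r in (0 : ℝ)..t, g r) := by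
  have hG : IsPrimitiveOn T (fun t => ∫ r in (0 : ℝ)..t, g r) g := ⟨hg, fun t _ => by simp⟩
  have hV : IsPrimitiveOn T (fun t => a + ∫ r in (0 : ℝ)..t, g r * s r) (fun r => g r * s r) :=
    ⟨hg.mul_continuousOn hs, fun t _ => by simp⟩
  have hG0 : ∀ t, 0 ≤ t → 0 ≤ ∫ r in (0 : ℝ)..t, g r := fun t ht =>
    intervalIntegral.integral_nonneg ht fun r _ => hg0 r
  intro t ht
  have hGt := hG.mono ht
  have hVt := hV.mono ht
  have hW := lipschitzWith_exp_neg_abs.comp_absolutelyContinuousOnInterval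
    (hGt.absolutelyContinuousOnInterval ht.1)
  have hle := (hVt.absolutelyContinuousOnInterval ht.1).integral_deriv_mul_eq_sub hW
  -- With `G = ∫ g` and `V = a + ∫ g s`, almost everywhere `-(V exp(-G))' = g exp(-G) (V - s) ≥ 0`.
  -- Hence `V exp(-G)` stays below its initial value `a`.
  have hneg : 0 ≤ ∫ r in (0 : ℝ)..t, -(deriv (fun t => a + ∫ r in (0 : ℝ)..t, g r * s r) r *
      Real.exp (-|∫ r in (0 : ℝ)..r, g r|) + (a + ∫ r in (0 : ℝ)..r, g r * s r) *
      deriv (fun t => Real.exp (-|∫ r in (0 : ℝ)..t, g r|)) r) := by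
    refine intervalIntegral.integral_nonneg_of_ae_restrict ht.1 ?_
    rw [Measure.restrict_congr_set Ioc_ae_eq_Icc.symm, EventuallyLE,
      ae_restrict_iff' measurableSet_Ioc]
    filter_upwards [hGt.ae_hasDerivAt ht.1, hVt.ae_hasDerivAt ht.1] with r h1 h2 hr
    have hr' : r ∈ Set.uIoc 0 t := by rwa [Set.uIoc_of_le ht.1]
    have hder : HasDerivAt (fun t => Real.exp (-|∫ r in (0 : ℝ)..t, g r|))
        (Real.exp (-(∫ r in (0 : ℝ)..r, g r)) * -g r) r := by
      refine ((h1 hr').neg.exp).congr_of_eventuallyEq ?_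
      filter_upwards [Ioi_mem_nhds hr.1] with q hq
      rw [abs_of_nonneg (hG0 q (le_of_lt hq))]
      rfl
    rw [(h2 hr').deriv, hder.deriv, abs_of_nonneg (hG0 r hr.1.le)]
    have h3 := h r ⟨hr.1.le, hr.2.trans ht.2⟩
    have h4 := mul_nonneg (hg0 r) (Real.exp_pos (-∫ r in (0 : ℝ)..r, g r)).le
    simp only [Pi.zero_apply]
    nlinarith [mul_nonneg h4 (sub_nonneg.2 h3)]
  rw [intervalIntegral.integral_neg] at hneg
  rw [hle] at hneg
  simp only [intervalIntegral.integral_same, abs_zero, neg_zero, Real.exp_zero, mul_one,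
    add_zero, abs_of_nonneg (hG0 t ht.1)] at hneg
  refine (h t ht).trans ?_
  have h5 : (a + ∫ r in (0 : ℝ)..t, g r * s r) * Real.exp (-∫ r in (0 : ℝ)..t, g r) ≤ a := by
    linarith
  rwa [Real.exp_neg, ← div_eq_mul_inv, div_le_iff₀ (Real.exp_pos _)] at h5

/-! ### Integrals of periodic and oscillating functions -/

/-- The primitive `F` satisfies `F(t + τ) = F(τ) + z F(t)`. Under either alternative of `h0` this
affine map has a fixed point `c`; then `‖F - c‖` is continuous and `τ`-periodic, hence bounded. -/
theorem exists_bound_integral_of_add_period {f : ℝ → ℂ} {τ : ℝ} {z : ℂ} (hτ : 0 < τ)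
    (hf : ∀ a b, IntervalIntegrable f volume a b) (hz : ‖z‖ = 1) (hper : ∀ t, f (t + τ) = z * f t)
    (h0 : z ≠ 1 ∨ ∫ t in (0 : ℝ)..τ, f t = 0) :
    ∃ C, ∀ t, ‖∫ s in (0 : ℝ)..t, f s‖ ≤ C := by
  obtain ⟨c, hc⟩ : ∃ c : ℂ, c = (∫ t in (0 : ℝ)..τ, f t) + z * c := by
    rcases h0 with h | h
    · have : 1 - z ≠ 0 := sub_ne_zero.2 h.symm
      refine ⟨(∫ t in (0 : ℝ)..τ, f t) / (1 - z), ?_⟩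
      field_simp
      ring
    · exact ⟨0, by simp [h]⟩
  have hshift : ∀ t, ∫ s in (0 : ℝ)..(t + τ), f s =
      (∫ s in (0 : ℝ)..τ, f s) + z * ∫ s in (0 : ℝ)..t, f s := fun t => by
    rw [← intervalIntegral.integral_add_adjacent_intervals (hf 0 τ) (hf τ (t + τ)),
      ← intervalIntegral.integral_const_mul]
    simp_rw [← hper]
    rw [intervalIntegral.integral_comp_add_right, zero_add]
  have hcont : Continuous fun t => ‖(∫ s in (0 : ℝ)..t, f s) - c‖ :=
    ((intervalIntegral.continuous_primitive hf 0).sub continuous_const).norm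
  have hp : Function.Periodic (fun t => ‖(∫ s in (0 : ℝ)..t, f s) - c‖) τ := fun t => by
    have : (∫ s in (0 : ℝ)..(t + τ), f s) - c = z * ((∫ s in (0 : ℝ)..t, f s) - c) := by
      rw [hshift]; linear_combination (-1 : ℂ) * hc
    simp only [this, norm_mul, hz, one_mul]
  obtain ⟨C, hC⟩ := (hp.isBounded_of_continuous hτ.ne' hcont).exists_norm_le
  refine ⟨C + ‖c‖, fun t => ?_⟩
  have h1 := hC _ ⟨t, rfl⟩
  rw [norm_norm] at h1
  have h2 := norm_add_le ((∫ s in (0 : ℝ)..t, f s) - c) c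
  rw [sub_add_cancel] at h2
  linarith

/-- Oscillatory integrals of a periodic function of zero mean are bounded off resonance. -/
theorem exists_bound_integral_exp_mul_periodic {p : ℝ → ℝ} {ω ν : ℝ} (hω : 0 < ω)
    (hp : Function.Periodic p (2 * Real.pi / ω)) (hint : ∀ a b, IntervalIntegrable p volume a b)
    (hmean : ∫ t in (0 : ℝ)..(2 * Real.pi / ω), p t = 0) (hν : ∀ l : ℤ, l ≠ 0 → ν ≠ l * ω) :
    ∃ C, ∀ t, ‖∫ s in (0 : ℝ)..t, Complex.exp (s * (ν * Complex.I)) * (p s : ℂ)‖ ≤ C := by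
  have hπ := Real.pi_pos
  refine exists_bound_integral_of_add_period (τ := 2 * Real.pi / ω)
    (z := Complex.exp (((2 * Real.pi / ω * ν : ℝ) : ℂ) * Complex.I)) (by positivity) ?_
    (Complex.norm_exp_ofReal_mul_I _) ?_ ?_
  · intro a b
    have : IntervalIntegrable (fun s => (p s : ℂ)) volume a b :=
      ⟨(hint a b).1.ofReal, (hint a b).2.ofReal⟩
    exact this.continuousOn_mul (by fun_prop)
  · intro t
    rw [hp t, ← mul_assoc (Complex.exp _) (Complex.exp _), ← Complex.exp_add]
    congr 2
    push_cast
    ring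
  -- For `ν = 0` the zero mean is what helps; for `ν ≠ 0`, `z = 1` would make `ν` a nonzero multiple
  -- of `ω`.
  · by_cases h : ν = 0
    · right
      subst h
      simpa [intervalIntegral.integral_ofReal] using hmean
    · left
      intro h1
      obtain ⟨m, hm⟩ := Complex.exp_eq_one_iff.1 h1
      have h2 : 2 * Real.pi / ω * ν = m * (2 * Real.pi) := by
        have h3 := congrArg Complex.im hm
        simpa using h3
      have h4 : ν = m * ω := by
        field_simp at h2
        rw [h2, mul_comm]
      refine hν m ?_ h4
      rintro rfl
      simp at h4
      exact h h4

/-- Round `t` up to a whole number of periods, at most `t / τ + 1` of them. -/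
theorem integral_le_of_periodic_nonneg {p : ℝ → ℝ} {τ : ℝ} (hτ : 0 < τ)
    (hp : Function.Periodic p τ) (hint : ∀ a b, IntervalIntegrable p volume a b)
    (h0 : ∀ t, 0 ≤ p t) {t : ℝ} (ht : 0 ≤ t) :
    ∫ s in (0 : ℝ)..t, p s ≤ (t / τ + 1) * ∫ s in (0 : ℝ)..τ, p s := by
  have hI : 0 ≤ ∫ s in (0 : ℝ)..τ, p s := intervalIntegral.integral_nonneg hτ.le fun s _ => h0 s
  have htN : t ≤ ⌈t / τ⌉ * τ := (div_le_iff₀ hτ).1 (Int.le_ceil _)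
  have h1 := hp.intervalIntegral_add_zsmul_eq ⌈t / τ⌉ 0 hint
  simp only [zero_add, zsmul_eq_mul] at h1
  calc ∫ s in (0 : ℝ)..t, p s ≤ ∫ s in (0 : ℝ)..(⌈t / τ⌉ * τ), p s :=
        intervalIntegral.integral_mono_interval le_rfl ht htN
          (Eventually.of_forall h0) (hint _ _)
    _ = ⌈t / τ⌉ * ∫ s in (0 : ℝ)..τ, p s := h1
    _ ≤ _ := mul_le_mul_of_nonneg_right (Int.ceil_lt_add_one _).le hI

namespace IsPeriodicL2

variable {n : ℕ} {ω : ℝ} {P : ℝ → Matrix (Fin n) (Fin n) ℝ}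

theorem periodic_apply (hP : IsPeriodicL2 ω P) (i j : Fin n) :
    Function.Periodic (fun t => P t i j) (2 * Real.pi / ω) := fun t => by
  simp only [hP.1 t]

theorem intervalIntegrable_apply (hω : 0 < ω) (hP : IsPeriodicL2 ω P) (i j : Fin n) (a b : ℝ) :
    IntervalIntegrable (fun t => P t i j) volume a b := by
  have hτ : 0 < 2 * Real.pi / ω := by have := Real.pi_pos; positivity
  refine (hP.periodic_apply i j).intervalIntegrable₀ hτ.ne' ?_ a b
  rw [intervalIntegrable_iff_integrableOn_Ioc_of_le hτ.le]
  exact (hP.2 i j).integrable (by norm_num)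

end IsPeriodicL2

/-! ### The matrix exponential -/

namespace Matrix

variable {n : ℕ}

theorem map_ofReal_exp (A : Matrix (Fin n) (Fin n) ℝ) :
    (NormedSpace.exp A).map Complex.ofReal = NormedSpace.exp (A.map Complex.ofReal) := by
  open scoped Matrix.Norms.Operator in
  have h := NormedSpace.map_exp (Complex.ofRealHom.mapMatrix (m := Fin n))
    (continuous_id.matrix_map Complex.continuous_ofReal) A
  exact h

theorem exp_smul_map_ofReal_of_mul_eq {A : Matrix (Fin n) (Fin n) ℝ}
    {S : Matrix (Fin n) (Fin n) ℂ} {d : Fin n → ℂ} (hS : IsUnit S)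
    (h : A.map Complex.ofReal * S = S * diagonal d) (t : ℝ) :
    (NormedSpace.exp (t • A)).map Complex.ofReal =
      S * diagonal (fun k => Complex.exp (t * d k)) * S⁻¹ := by
  have hdet := (Matrix.isUnit_iff_isUnit_det S).1 hS
  have hA : (t • A).map Complex.ofReal = S * diagonal (fun k => (t : ℂ) * d k) * S⁻¹ := by
    have h1 : (t • A).map Complex.ofReal = (t : ℂ) • A.map Complex.ofReal := by
      ext i j; simp
    have h2 : diagonal (fun k => (t : ℂ) * d k) = (t : ℂ) • diagonal d := by
      rw [← diagonal_smul]; rfl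
    rw [h1, h2, Matrix.mul_smul, Matrix.smul_mul, ← h, Matrix.mul_assoc,
      Matrix.mul_nonsing_inv S hdet, Matrix.mul_one]
  rw [map_ofReal_exp, hA, Matrix.exp_conj _ _ hS, Matrix.exp_diagonal]
  congr 3
  ext k
  rw [Pi.coe_exp, Complex.exp_eq_exp_ℂ]

theorem hasDerivAt_exp_smul_apply (A : Matrix (Fin n) (Fin n) ℝ) (i j : Fin n) (t : ℝ) :
    HasDerivAt (fun s : ℝ => NormedSpace.exp (s • A) i j) ((NormedSpace.exp (t • A) * A) i j) t := by
  open scoped Matrix.Norms.Operator in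
  have h := hasDerivAt_exp_smul_const (𝕂 := ℝ) A t
  open scoped Matrix.Norms.Operator in
  exact ((Matrix.entryLinearMap ℝ ℝ i j).toContinuousLinearMap.hasFDerivAt.comp_hasDerivAt t h)

theorem continuous_exp_smul_apply (A : Matrix (Fin n) (Fin n) ℝ) (i j : Fin n) :
    Continuous fun s : ℝ => NormedSpace.exp (s • A) i j :=
  continuous_iff_continuousAt.2 fun t => (hasDerivAt_exp_smul_apply A i j t).continuousAt

theorem isPrimitiveOn_exp_smul_apply (A : Matrix (Fin n) (Fin n) ℝ) (i j : Fin n) (T : ℝ) :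
    IsPrimitiveOn T (fun s => NormedSpace.exp (s • A) i j)
      (fun s => (NormedSpace.exp (s • A) * A) i j) := by
  have hc : Continuous fun s : ℝ => (NormedSpace.exp (s • A) * A) i j := by
    simp only [Matrix.mul_apply]
    exact continuous_finsetSum _ fun k _ => (continuous_exp_smul_apply A i k).mul continuous_const
  refine ⟨hc.intervalIntegrable _ _, fun t _ => ?_⟩
  rw [intervalIntegral.integral_eq_sub_of_hasDerivAt
    (fun s _ => hasDerivAt_exp_smul_apply A i j s) (hc.intervalIntegrable _ _)]
  ring

theorem exp_neg_mul_exp (A : Matrix (Fin n) (Fin n) ℝ) :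
    NormedSpace.exp (-A) * NormedSpace.exp A = 1 := by
  rw [← Matrix.exp_add_of_commute _ _ (Commute.refl A).neg_left, neg_add_cancel,
    NormedSpace.exp_zero]

theorem exp_mul_exp_neg (A : Matrix (Fin n) (Fin n) ℝ) :
    NormedSpace.exp A * NormedSpace.exp (-A) = 1 := by
  simpa using exp_neg_mul_exp (-A)

end Matrix

/-! ### The conjugated perturbation in an eigenbasis -/

theorem complexEigenvalues_eq_range {n : ℕ} {A : Matrix (Fin n) (Fin n) ℝ}
    {S : Matrix (Fin n) (Fin n) ℂ} {d : Fin n → ℂ} (hS : IsUnit S)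
    (h : A.map Complex.ofReal * S = S * Matrix.diagonal d) :
    complexEigenvalues A = Set.range d := by
  obtain ⟨U, rfl⟩ := hS
  have h1 : A.map Complex.ofReal = U * Matrix.diagonal d * (U⁻¹ : (Matrix (Fin n) (Fin n) ℂ)ˣ) := by
    rw [← h, Units.mul_inv_cancel_right]
  rw [complexEigenvalues, h1, spectrum.units_conjugate, spectrum_diagonal]

/-- The entries of the conjugated perturbation, in a basis of eigenvectors of `A`. -/
theorem conjPerturbation_apply_eq_sum {n : ℕ} {A : Matrix (Fin n) (Fin n) ℝ}
    {S : Matrix (Fin n) (Fin n) ℂ} {d : Fin n → ℂ} (hS : IsUnit S)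
    (h : A.map Complex.ofReal * S = S * Matrix.diagonal d)
    (P : ℝ → Matrix (Fin n) (Fin n) ℝ) (t : ℝ) (i j : Fin n) :
    (conjPerturbation A P t i j : ℂ) = ∑ q : (Fin n × Fin n) × (Fin n × Fin n),
      (S i q.1.1 * S⁻¹ q.1.1 q.2.1 * S q.2.2 q.1.2 * S⁻¹ q.1.2 j) *
        (Complex.exp (t * (d q.1.2 - d q.1.1)) * (P t q.2.1 q.2.2 : ℂ)) := by
  have hmap : (conjPerturbation A P t).map Complex.ofReal =
      S * Matrix.diagonal (fun k => Complex.exp ((-t : ℝ) * d k)) * S⁻¹ *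
        (P t).map Complex.ofReal *
        (S * Matrix.diagonal (fun k => Complex.exp (t * d k)) * S⁻¹) := by
    rw [← Matrix.exp_smul_map_ofReal_of_mul_eq hS h, ← Matrix.exp_smul_map_ofReal_of_mul_eq hS h,
      conjPerturbation, neg_smul]
    have hmul : ∀ M N : Matrix (Fin n) (Fin n) ℝ,
        (M * N).map Complex.ofReal = M.map Complex.ofReal * N.map Complex.ofReal :=
      fun M N => Matrix.map_mul (f := Complex.ofRealHom)
    rw [hmul, hmul]
  have hentry : (conjPerturbation A P t i j : ℂ) =
      (conjPerturbation A P t).map Complex.ofReal i j := rfl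
  rw [hentry, hmap, Fintype.sum_prod_type, Fintype.sum_prod_type]
  have hassoc : S * Matrix.diagonal (fun k => Complex.exp ((-t : ℝ) * d k)) * S⁻¹ *
      (P t).map Complex.ofReal * (S * Matrix.diagonal (fun k => Complex.exp (t * d k)) * S⁻¹) =
      (S * Matrix.diagonal (fun k => Complex.exp ((-t : ℝ) * d k))) * ((S⁻¹ *
      (P t).map Complex.ofReal * S) * (Matrix.diagonal (fun k => Complex.exp (t * d k)) * S⁻¹)) := by
    simp only [Matrix.mul_assoc]
  rw [hassoc, Matrix.mul_apply]
  refine Finset.sum_congr rfl fun k _ => ?_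
  rw [Matrix.mul_diagonal, Matrix.mul_apply, Finset.mul_sum]
  refine Finset.sum_congr rfl fun l _ => ?_
  -- Here `k`, `l` index eigenvectors and `a`, `b` the entries of `P`. Expanding `(S⁻¹ P) S`
  -- produces the sum over `b` outermost.
  rw [Matrix.diagonal_mul, Matrix.mul_apply, Fintype.sum_prod_type_right,
    Finset.sum_mul, Finset.mul_sum]
  refine Finset.sum_congr rfl fun b _ => ?_
  rw [Matrix.mul_apply, Finset.sum_mul, Finset.sum_mul, Finset.mul_sum]
  refine Finset.sum_congr rfl fun a _ => ?_
  have hexp : Complex.exp (t * (d l - d k)) =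
      Complex.exp ((-t : ℝ) * d k) * Complex.exp (t * d l) := by
    rw [← Complex.exp_add]; congr 1; push_cast; ring
  rw [hexp, Matrix.map_apply]
  ring

theorem intervalIntegrable_conjPerturbation_apply {n : ℕ} {ω : ℝ} (hω : 0 < ω)
    (A : Matrix (Fin n) (Fin n) ℝ) {P : ℝ → Matrix (Fin n) (Fin n) ℝ} (hP : IsPeriodicL2 ω P)
    (i j : Fin n) (a b : ℝ) :
    IntervalIntegrable (fun t => conjPerturbation A P t i j) volume a b := by
  have hc : ∀ k l, Continuous fun t : ℝ => NormedSpace.exp (-(t • A)) k l := fun k l => by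
    simpa only [smul_neg] using Matrix.continuous_exp_smul_apply (-A) k l
  have h : ∀ k ∈ Finset.univ, IntervalIntegrable (fun t => ∑ l, NormedSpace.exp (-(t • A)) i l *
      P t l k * NormedSpace.exp (t • A) k j) volume a b := fun k _ => by
    have := IntervalIntegrable.sum Finset.univ (μ := volume) (a := a) (b := b)
      (f := fun l t => NormedSpace.exp (-(t • A)) i l * P t l k * NormedSpace.exp (t • A) k j)
      fun l _ => ((hP.intervalIntegrable_apply hω l k a b).continuousOn_mul
        (hc i l).continuousOn).mul_continuousOn
          (Matrix.continuous_exp_smul_apply A k j).continuousOn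
    rwa [Finset.sum_fn] at this
  have := IntervalIntegrable.sum _ h
  rw [Finset.sum_fn] at this
  refine this.congr fun t _ => ?_
  simp only [conjPerturbation, Matrix.mul_apply, Finset.sum_mul]

/-- Under the non-resonance condition the primitive of the conjugated perturbation is bounded. -/
theorem exists_bound_integral_conjPerturbation {n : ℕ} {A : Matrix (Fin n) (Fin n) ℝ} {ω : ℝ}
    (hω : 0 < ω) {P : ℝ → Matrix (Fin n) (Fin n) ℝ} (hP : IsPeriodicL2 ω P)
    (hmean : ∀ i j, ∫ t in (0 : ℝ)..(2 * Real.pi / ω), P t i j = 0)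
    (hdiag : IsComplexDiagonalizable A)
    (hre : ∀ z ∈ complexEigenvalues A, ∀ w ∈ complexEigenvalues A, z.re = w.re)
    (hres : ∀ z ∈ complexEigenvalues A, ∀ w ∈ complexEigenvalues A, ∀ l : ℤ, l ≠ 0 →
      |z.im - w.im| ≠ l * ω) (i j : Fin n) :
    ∃ C, ∀ t, |∫ s in (0 : ℝ)..t, conjPerturbation A P s i j| ≤ C := by
  obtain ⟨S, d, hS, h⟩ := hdiag
  rw [complexEigenvalues_eq_range hS h] at hre hres
  have hint := hP.intervalIntegrable_apply hω
  have hosc : ∀ q : (Fin n × Fin n) × (Fin n × Fin n), ∃ C, ∀ t, ‖∫ s in (0 : ℝ)..t,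
      Complex.exp (s * (d q.1.2 - d q.1.1)) * (P s q.2.1 q.2.2 : ℂ)‖ ≤ C := by
    rintro ⟨⟨k, l⟩, a, b⟩
    -- Equal real parts make the exponent purely imaginary.
    have hd : d l - d k = (((d l).im - (d k).im : ℝ) : ℂ) * Complex.I := by
      apply Complex.ext
      · simpa using sub_eq_zero.2 (hre _ ⟨l, rfl⟩ _ ⟨k, rfl⟩)
      · simp
    simp only [hd]
    refine exists_bound_integral_exp_mul_periodic hω (hP.periodic_apply a b) (hint a b)
      (hmean a b) fun m hm hν => ?_
    refine hres _ ⟨l, rfl⟩ _ ⟨k, rfl⟩ |m| (abs_ne_zero.2 hm) ?_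
    rw [hν, abs_mul, abs_of_pos hω, Int.cast_abs]
  choose C hC using hosc
  refine ⟨∑ q : (Fin n × Fin n) × (Fin n × Fin n),
    ‖S i q.1.1 * S⁻¹ q.1.1 q.2.1 * S q.2.2 q.1.2 * S⁻¹ q.1.2 j‖ * C q, fun t => ?_⟩
  rw [← Real.norm_eq_abs, ← Complex.norm_real, ← intervalIntegral.integral_ofReal]
  simp only [conjPerturbation_apply_eq_sum hS h]
  rw [intervalIntegral.integral_finsetSum]
  · refine (norm_sum_le _ _).trans (Finset.sum_le_sum fun q _ => ?_)
    rw [intervalIntegral.integral_const_mul, norm_mul]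
    exact mul_le_mul_of_nonneg_left (hC q t) (norm_nonneg _)
  · intro q _
    have hq : IntervalIntegrable (fun s => (P s q.2.1 q.2.2 : ℂ)) volume 0 t :=
      ⟨(hint _ _ 0 t).1.ofReal, (hint _ _ 0 t).2.ofReal⟩
    exact (hq.continuousOn_mul (by fun_prop)).const_mul _

/-- The exponentials in the eigenbasis expansion have modulus one, so conjugation costs only a
factor independent of time. -/
theorem exists_abs_conjPerturbation_le {n : ℕ} {A : Matrix (Fin n) (Fin n) ℝ}
    (P : ℝ → Matrix (Fin n) (Fin n) ℝ) (hdiag : IsComplexDiagonalizable A)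
    (hre : ∀ z ∈ complexEigenvalues A, ∀ w ∈ complexEigenvalues A, z.re = w.re) (i j : Fin n) :
    ∃ C, 0 ≤ C ∧ ∀ t, |conjPerturbation A P t i j| ≤ C * ∑ a, ∑ b, |P t a b| := by
  obtain ⟨S, d, hS, h⟩ := hdiag
  rw [complexEigenvalues_eq_range hS h] at hre
  refine ⟨∑ q : (Fin n × Fin n) × (Fin n × Fin n),
    ‖S i q.1.1 * S⁻¹ q.1.1 q.2.1 * S q.2.2 q.1.2 * S⁻¹ q.1.2 j‖,
    Finset.sum_nonneg fun _ _ => norm_nonneg _, fun t => ?_⟩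
  rw [← Real.norm_eq_abs, ← Complex.norm_real, conjPerturbation_apply_eq_sum hS h, Finset.sum_mul]
  refine (norm_sum_le _ _).trans (Finset.sum_le_sum fun q _ => ?_)
  rw [norm_mul]
  refine mul_le_mul_of_nonneg_left ?_ (norm_nonneg _)
  have hd : (t : ℂ) * (d q.1.2 - d q.1.1) =
      ((t * ((d q.1.2).im - (d q.1.1).im) : ℝ) : ℂ) * Complex.I := by
    have hr := hre _ ⟨q.1.2, rfl⟩ _ ⟨q.1.1, rfl⟩
    apply Complex.ext <;> simp [hr]
  rw [norm_mul, hd, Complex.norm_exp_ofReal_mul_I, one_mul, Complex.norm_real, Real.norm_eq_abs]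
  calc |P t q.2.1 q.2.2| ≤ ∑ b, |P t q.2.1 b| :=
        Finset.single_le_sum (fun b _ => abs_nonneg (P t q.2.1 b)) (Finset.mem_univ _)
    _ ≤ _ := Finset.single_le_sum (f := fun a => ∑ b, |P t a b|)
        (fun a _ => Finset.sum_nonneg fun b _ => abs_nonneg _) (Finset.mem_univ _)

theorem isEffectiveMatrix_zero_of_bounded {n : ℕ} {A : Matrix (Fin n) (Fin n) ℝ}
    {P : ℝ → Matrix (Fin n) (Fin n) ℝ}
    (h : ∀ i j, ∃ C, ∀ t, |∫ s in (0 : ℝ)..t, conjPerturbation A P s i j| ≤ C) :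
    IsEffectiveMatrix A P 0 := by
  intro i j
  obtain ⟨C, hC⟩ := h i j
  have h0 : Tendsto (fun T : ℝ => C / T) atTop (𝓝 0) := tendsto_const_nhds.div_atTop tendsto_id
  refine squeeze_zero_norm' ?_ h0
  filter_upwards [eventually_gt_atTop 0] with T hT
  rw [Real.norm_eq_abs, abs_mul, abs_of_pos (by positivity), one_div, inv_mul_eq_div]
  exact div_le_div_of_nonneg_right (hC T) hT.le

/-- Linear growth is exactly what keeps `ε ∫ |Q|` bounded on times of order `1/ε`; the `+ 1` pays
for an incomplete period. -/
theorem exists_bound_integral_sum_abs_conjPerturbation {n : ℕ} {A : Matrix (Fin n) (Fin n) ℝ}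
    {ω : ℝ} (hω : 0 < ω) {P : ℝ → Matrix (Fin n) (Fin n) ℝ} (hP : IsPeriodicL2 ω P)
    (hdiag : IsComplexDiagonalizable A)
    (hre : ∀ z ∈ complexEigenvalues A, ∀ w ∈ complexEigenvalues A, z.re = w.re) :
    ∃ C, 0 ≤ C ∧ ∀ t, 0 ≤ t →
      ∫ s in (0 : ℝ)..t, ∑ i, ∑ j, |conjPerturbation A P s i j| ≤ C * (t + 1) := by
  choose κ hκ0 hκ using exists_abs_conjPerturbation_le P hdiag hre
  set τ := 2 * Real.pi / ω with hτdef
  have hτ : 0 < τ := by have := Real.pi_pos; positivity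
  have hpint : ∀ a b, IntervalIntegrable (fun t => ∑ k, ∑ l, |P t k l|) volume a b :=
    fun a b => by
      have := IntervalIntegrable.sum (Finset.univ : Finset (Fin n × Fin n)) (μ := volume) (a := a)
        (b := b) (f := fun q t => |P t q.1 q.2|)
        fun q _ => (hP.intervalIntegrable_apply hω q.1 q.2 a b).abs
      rw [Finset.sum_fn] at this
      simpa only [Fintype.sum_prod_type] using this
  have hqint : ∀ a b, IntervalIntegrable
      (fun t => ∑ i, ∑ j, |conjPerturbation A P t i j|) volume a b := fun a b => by
    have := IntervalIntegrable.sum (Finset.univ : Finset (Fin n × Fin n)) (μ := volume) (a := a)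
      (b := b) (f := fun q t => |conjPerturbation A P t q.1 q.2|)
      fun q _ => (intervalIntegrable_conjPerturbation_apply hω A hP q.1 q.2 a b).abs
    rw [Finset.sum_fn] at this
    simpa only [Fintype.sum_prod_type] using this
  have hper : Function.Periodic (fun t => ∑ k, ∑ l, |P t k l|) τ := fun t => by
    simp only [hP.1 t, hτdef]
  have hp0 : ∀ t, 0 ≤ ∑ k, ∑ l, |P t k l| := fun t =>
    Finset.sum_nonneg fun _ _ => Finset.sum_nonneg fun _ _ => abs_nonneg _
  set κ' := ∑ i, ∑ j, κ i j with hκ'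
  have hκ'0 : 0 ≤ κ' := Finset.sum_nonneg fun _ _ => Finset.sum_nonneg fun _ _ => hκ0 _ _
  set I := ∫ s in (0 : ℝ)..τ, ∑ k, ∑ l, |P s k l| with hI
  have hI0 : 0 ≤ I := intervalIntegral.integral_nonneg hτ.le fun s _ => hp0 s
  refine ⟨κ' * I * (τ⁻¹ + 1), by positivity, fun t ht => ?_⟩
  calc ∫ s in (0 : ℝ)..t, ∑ i, ∑ j, |conjPerturbation A P s i j|
      ≤ ∫ s in (0 : ℝ)..t, κ' * ∑ k, ∑ l, |P s k l| := by
        refine intervalIntegral.integral_mono_on ht (hqint _ _) ((hpint _ _).const_mul _)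
          fun s _ => ?_
        rw [hκ', Finset.sum_mul]
        refine Finset.sum_le_sum fun i _ => ?_
        rw [Finset.sum_mul]
        exact Finset.sum_le_sum fun j _ => hκ i j s
    _ = κ' * ∫ s in (0 : ℝ)..t, ∑ k, ∑ l, |P s k l| := intervalIntegral.integral_const_mul _ _
    _ ≤ κ' * ((t / τ + 1) * I) := mul_le_mul_of_nonneg_left
        (integral_le_of_periodic_nonneg hτ hper hpint hp0 ht) hκ'0
    _ ≤ κ' * I * (τ⁻¹ + 1) * (t + 1) := by
        have h1 : (0 : ℝ) ≤ τ⁻¹ := by positivity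
        have h2 : t / τ + 1 ≤ (τ⁻¹ + 1) * (t + 1) := by
          rw [div_eq_mul_inv]; nlinarith
        calc κ' * ((t / τ + 1) * I) = κ' * I * (t / τ + 1) := by ring
          _ ≤ κ' * I * ((τ⁻¹ + 1) * (t + 1)) :=
            mul_le_mul_of_nonneg_left h2 (mul_nonneg hκ'0 hI0)
          _ = _ := by ring

/-! ### The averaging estimate -/

theorem sum_abs_mulVec_le {n : ℕ} (Q : Matrix (Fin n) (Fin n) ℝ) (y : Fin n → ℝ) :
    ∑ i, |(Q.mulVec y) i| ≤ (∑ i, ∑ j, |Q i j|) * ∑ j, |y j| := by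
  rw [Finset.sum_mul]
  refine Finset.sum_le_sum fun i _ => ?_
  rw [Finset.sum_mul]
  change |∑ j, Q i j * y j| ≤ _
  refine (Finset.abs_sum_le_sum_abs _ _).trans (Finset.sum_le_sum fun j _ => ?_)
  rw [abs_mul]
  exact mul_le_mul_of_nonneg_left
    (Finset.single_le_sum (f := fun j => |y j|) (fun j _ => abs_nonneg (y j)) (Finset.mem_univ j)) (abs_nonneg _)

/-- First-order averaging when the coefficient matrix `Q` has a bounded primitive: solutions of
`y' = ε Q(t) y` stay `O(ε)`-close to their initial value. -/
theorem sum_abs_sub_initial_le_of_bounded_primitive {n : ℕ} {Q : ℝ → Matrix (Fin n) (Fin n) ℝ}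
    {y : ℝ → Fin n → ℝ} {ε T a : ℝ} {r : Fin n → Fin n → ℝ} (hε : 0 < ε) (hT : 0 ≤ T)
    (hQ : ∀ i j a b, IntervalIntegrable (fun t => Q t i j) volume a b)
    (hy : ∀ i, IsPrimitiveOn T (fun t => y t i) (fun t => ε * (Q t).mulVec (y t) i))
    (hr : ∀ i j t, |∫ s in (0 : ℝ)..t, Q s i j| ≤ r i j) (ha : 0 ≤ a)
    (hqa : ∀ t, 0 ≤ t → ∫ s in (0 : ℝ)..t, ∑ i, ∑ j, |Q s i j| ≤ a * (t + 1)) :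
    ∀ t ∈ Set.Icc 0 T, ∑ i, |y t i - y 0 i| ≤
      ε * (∑ i, ∑ j, r i j) * (1 + a * (ε * (T + 1))) *
        (Real.exp (a * (ε * (T + 1))) * ∑ i, |y 0 i|) := by
  have hr0 : ∀ i j, 0 ≤ r i j := fun i j => (abs_nonneg _).trans (hr i j 0)
  have hq : ∀ a b, IntervalIntegrable (fun t => ∑ i, ∑ j, |Q t i j|) volume a b := fun a b => by
    have := IntervalIntegrable.sum (Finset.univ : Finset (Fin n × Fin n)) (μ := volume) (a := a)
      (b := b) (f := fun q t => |Q t q.1 q.2|) fun q _ => (hQ q.1 q.2 a b).abs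
    rw [Finset.sum_fn] at this
    simpa only [Fintype.sum_prod_type] using this
  have hq0 : ∀ t, 0 ≤ ∑ i, ∑ j, |Q t i j| := fun t =>
    Finset.sum_nonneg fun _ _ => Finset.sum_nonneg fun _ _ => abs_nonneg _
  have hs : ContinuousOn (fun t => ∑ i, |y t i|) (Set.uIcc 0 T) :=
    continuousOn_finsetSum _ fun i _ => ((hy i).continuousOn hT).abs
  have hQy : ∀ i, IntervalIntegrable (fun t => (Q t).mulVec (y t) i) volume 0 T := fun i => by
    refine ((hy i).1.const_mul ε⁻¹).congr fun t _ => ?_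
    field_simp
  have hsub : ∀ t ∈ Set.Icc 0 T, Set.uIcc 0 t ⊆ Set.uIcc 0 T := fun t ht => by
    rw [Set.uIcc_of_le ht.1, Set.uIcc_of_le hT]
    exact Set.Icc_subset_Icc le_rfl ht.2
  have hqT : ∀ t ∈ Set.Icc 0 T, ε * ∫ s in (0 : ℝ)..t, ∑ i, ∑ j, |Q s i j| ≤
      a * (ε * (T + 1)) := fun t ht => by
    have h1 := hqa t ht.1
    have h2 : a * (t + 1) ≤ a * (T + 1) := mul_le_mul_of_nonneg_left (by linarith [ht.2]) ha
    calc _ ≤ ε * (a * (T + 1)) := mul_le_mul_of_nonneg_left (h1.trans h2) hε.le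
      _ = _ := by ring
  -- A priori bound on `y` in the `ℓ¹` norm, by Grönwall with coefficient `ε ∑ |Q i j|`.
  have hbound : ∀ t ∈ Set.Icc 0 T,
      ∑ i, |y t i| ≤ Real.exp (a * (ε * (T + 1))) * ∑ i, |y 0 i| := by
    intro t ht
    have hgr := le_mul_exp_integral_of_le_add_integral (a := ∑ i, |y 0 i|)
      ((hq 0 T).const_mul ε) (fun t => mul_nonneg hε.le (hq0 t)) hs (fun t ht => ?_) t ht
    · rw [intervalIntegral.integral_const_mul] at hgr
      rw [mul_comm]
      exact hgr.trans (mul_le_mul_of_nonneg_left (Real.exp_le_exp.2 (hqT t ht))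
        (Finset.sum_nonneg fun _ _ => abs_nonneg _))
    · have hab : ∀ i, IntervalIntegrable (fun s => |ε * (Q s).mulVec (y s) i|) volume 0 t :=
        fun i => ((hy i).mono ht).1.abs
      calc ∑ i, |y t i| ≤ ∑ i, (|y 0 i| + ∫ s in (0 : ℝ)..t, |ε * (Q s).mulVec (y s) i|) := by
            refine Finset.sum_le_sum fun i _ => ?_
            have hyt : y t i = y 0 i + ∫ s in (0 : ℝ)..t, ε * (Q s).mulVec (y s) i := (hy i).2 t ht
            rw [hyt]
            exact (abs_add_le _ _).trans (by
              gcongr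
              exact intervalIntegral.abs_integral_le_integral_abs ht.1)
        _ = ∑ i, |y 0 i| + ∫ s in (0 : ℝ)..t, ∑ i, |ε * (Q s).mulVec (y s) i| := by
            rw [Finset.sum_add_distrib, intervalIntegral.integral_finsetSum fun i _ => hab i]
        _ ≤ _ := by
            refine add_le_add le_rfl (intervalIntegral.integral_mono_on ht.1 ?_ ?_ fun s _ => ?_)
            · have := IntervalIntegrable.sum Finset.univ fun i _ => hab i
              rwa [Finset.sum_fn] at this
            · exact ((hq 0 t).const_mul ε).mul_continuousOn (hs.mono (hsub t ht))
            · simp only [abs_mul, abs_of_pos hε, ← Finset.mul_sum, mul_assoc]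
              exact mul_le_mul_of_nonneg_left (sum_abs_mulVec_le _ _) hε.le
  set Y := Real.exp (a * (ε * (T + 1))) * ∑ i, |y 0 i| with hY
  have hY0 : 0 ≤ Y := mul_nonneg (Real.exp_pos _).le (Finset.sum_nonneg fun _ _ => abs_nonneg _)
  intro t ht
  have hterm : ∀ i, |y t i - y 0 i| ≤
      ε * (∑ j, r i j) * (1 + a * (ε * (T + 1))) * Y := by
    intro i
    have hR : ∀ j, IsPrimitiveOn T (fun t => ∫ s in (0 : ℝ)..t, Q s i j) (fun t => Q t i j) :=
      fun j => ⟨hQ i j 0 T, fun t _ => by simp⟩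
    -- Integrate `(R y)' = Q y + ε R Q y`, where `R = ∫ Q` vanishes at 0; solving for `∫ Q y` gives
    -- `heq`.
    have hZ := (IsPrimitiveOn.sum Finset.univ fun j _ => (hR j).mul hT (hy j)).2 t ht
    have hW : IntervalIntegrable (fun s => ∑ j, (∫ r in (0 : ℝ)..s, Q r i j) *
        (Q s).mulVec (y s) j) volume 0 t := by
      have := IntervalIntegrable.sum (μ := volume) (a := 0) (b := t) Finset.univ
        (f := fun j s => (∫ r in (0 : ℝ)..s, Q r i j) * (Q s).mulVec (y s) j)
        fun j _ => ((hQy j).mono_set (hsub t ht)).continuousOn_mul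
          (((hR j).mono ht).continuousOn ht.1)
      rwa [Finset.sum_fn] at this
    have hsplit : ∀ s, ∑ j, (Q s i j * y s j +
        (∫ r in (0 : ℝ)..s, Q r i j) * (ε * (Q s).mulVec (y s) j)) =
        (Q s).mulVec (y s) i + ε * ∑ j, (∫ r in (0 : ℝ)..s, Q r i j) * (Q s).mulVec (y s) j :=
      fun s => by
        rw [Finset.sum_add_distrib, Finset.mul_sum]
        congr 1
        exact Finset.sum_congr rfl fun j _ => by ring
    simp only [hsplit, intervalIntegral.integral_same, zero_mul, Finset.sum_const_zero,
      zero_add] at hZ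
    rw [intervalIntegral.integral_add ((hQy i).mono_set (hsub t ht)) (hW.const_mul ε),
      intervalIntegral.integral_const_mul] at hZ
    have hyt : y t i = y 0 i + ∫ s in (0 : ℝ)..t, ε * (Q s).mulVec (y s) i := (hy i).2 t ht
    rw [intervalIntegral.integral_const_mul] at hyt
    have heq : y t i - y 0 i = ε * ∑ j, (∫ s in (0 : ℝ)..t, Q s i j) * y t j -
        ε * (ε * ∫ s in (0 : ℝ)..t, ∑ j, (∫ r in (0 : ℝ)..s, Q r i j) * (Q s).mulVec (y s) j) := by
      rw [hZ, hyt]; ring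
    have hfirst : |∑ j, (∫ s in (0 : ℝ)..t, Q s i j) * y t j| ≤ (∑ j, r i j) * Y := by
      rw [Finset.sum_mul]
      refine (Finset.abs_sum_le_sum_abs _ _).trans (Finset.sum_le_sum fun j _ => ?_)
      rw [abs_mul]
      exact mul_le_mul (hr i j t) ((Finset.single_le_sum (fun j _ => abs_nonneg (y t j))
        (Finset.mem_univ j)).trans (hbound t ht)) (abs_nonneg _) (hr0 i j)
    -- `R` is bounded by `r` and `y` by `Y`, so only `∫ |Q|` grows with `t`; one of the two factors
    -- `ε` in front absorbs it.
    have hsecond : |∫ s in (0 : ℝ)..t, ∑ j, (∫ r in (0 : ℝ)..s, Q r i j) * (Q s).mulVec (y s) j| ≤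
        (∑ j, r i j) * Y * ∫ s in (0 : ℝ)..t, ∑ i, ∑ j, |Q s i j| := by
      rw [← intervalIntegral.integral_const_mul]
      refine (intervalIntegral.abs_integral_le_integral_abs ht.1).trans
        (intervalIntegral.integral_mono_on ht.1 hW.abs ((hq 0 t).const_mul _) fun s hs => ?_)
      rw [mul_assoc, Finset.sum_mul]
      refine (Finset.abs_sum_le_sum_abs _ _).trans (Finset.sum_le_sum fun j _ => ?_)
      rw [abs_mul]
      refine mul_le_mul (hr i j s) ?_ (abs_nonneg _) (hr0 i j)
      rw [mul_comm]
      exact (Finset.single_le_sum (fun j _ => abs_nonneg ((Q s).mulVec (y s) j))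
        (Finset.mem_univ j)).trans ((sum_abs_mulVec_le _ _).trans
          (mul_le_mul_of_nonneg_left (hbound s ⟨hs.1, hs.2.trans ht.2⟩) (hq0 s)))
    have hri : 0 ≤ (∑ j, r i j) * Y := mul_nonneg (Finset.sum_nonneg fun j _ => hr0 i j) hY0
    rw [heq]
    calc _ ≤ ε * |∑ j, (∫ s in (0 : ℝ)..t, Q s i j) * y t j| + ε * (ε *
          |∫ s in (0 : ℝ)..t, ∑ j, (∫ r in (0 : ℝ)..s, Q r i j) * (Q s).mulVec (y s) j|) := by
          refine (abs_sub _ _).trans_eq ?_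
          simp only [abs_mul, abs_of_pos hε]
      _ ≤ ε * ((∑ j, r i j) * Y) + ε * (ε *
          ((∑ j, r i j) * Y * ∫ s in (0 : ℝ)..t, ∑ i, ∑ j, |Q s i j|)) := by gcongr
      _ = ε * ((∑ j, r i j) * Y) + ε * ((∑ j, r i j) * Y *
          (ε * ∫ s in (0 : ℝ)..t, ∑ i, ∑ j, |Q s i j|)) := by ring
      _ ≤ ε * ((∑ j, r i j) * Y) + ε * ((∑ j, r i j) * Y * (a * (ε * (T + 1)))) := by
          exact add_le_add le_rfl <| mul_le_mul_of_nonneg_left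
            (mul_le_mul_of_nonneg_left (hqT t ht) hri) hε.le
      _ = _ := by ring
  calc _ ≤ ∑ i, ε * (∑ j, r i j) * (1 + a * (ε * (T + 1))) * Y :=
        Finset.sum_le_sum fun i _ => hterm i
    _ = _ := by rw [← Finset.sum_mul, ← Finset.sum_mul, ← Finset.mul_sum]

/-! ### The moving frame and the conclusion -/

namespace IsSolutionOn

variable {n : ℕ} {A : Matrix (Fin n) (Fin n) ℝ} {P : ℝ → Matrix (Fin n) (Fin n) ℝ} {ε T : ℝ}
  {x : ℝ → EuclideanSpace ℝ (Fin n)}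

theorem isPrimitiveOn_apply (hT : 0 ≤ T) (h : IsSolutionOn A ε P (fun _ => 0) T x) (i : Fin n) :
    IsPrimitiveOn T (fun t => x t i) (fun s => (A + ε • P s).mulVec (x s).ofLp i) := by
  obtain ⟨-, hint, hx⟩ := h
  simp only [add_zero] at hint hx
  let L : EuclideanSpace ℝ (Fin n) →L[ℝ] ℝ := EuclideanSpace.proj i
  refine ⟨⟨L.integrable_comp hint.1, L.integrable_comp hint.2⟩, fun t ht => ?_⟩
  have hint' : IntervalIntegrable (fun s => Matrix.toEuclideanLin (A + ε • P s) (x s))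
      volume 0 t := hint.mono_set (by
    rw [Set.uIcc_of_le ht.1, Set.uIcc_of_le hT]
    exact Set.Icc_subset_Icc le_rfl ht.2)
  have h1 := congrArg L (hx t ht)
  rw [map_add, ← L.intervalIntegral_comp_comm hint'] at h1
  exact h1

/-- In the frame moving with `exp(tA)`, a solution satisfies `y' = ε exp(-At) P(t) exp(At) y`. -/
theorem isPrimitiveOn_exp_neg_mulVec (hT : 0 ≤ T) (h : IsSolutionOn A ε P (fun _ => 0) T x)
    (i : Fin n) :
    IsPrimitiveOn T (fun t => (NormedSpace.exp (-(t • A))).mulVec (x t).ofLp i)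
      (fun t => ε * (conjPerturbation A P t).mulVec
        ((NormedSpace.exp (-(t • A))).mulVec (x t).ofLp) i) := by
  have hsum := IsPrimitiveOn.sum Finset.univ fun j _ =>
    (Matrix.isPrimitiveOn_exp_smul_apply (-A) i j T).mul hT (h.isPrimitiveOn_apply hT j)
  refine hsum.congr hT (fun t _ => ?_) fun t _ => ?_
  · simp only [smul_neg, Matrix.mulVec, dotProduct]
  -- The two terms containing `A` cancel, and `exp(tA) exp(-tA) = 1` is inserted to the right of
  -- `P`.
  · have hvec : (NormedSpace.exp (t • -A) * -A).mulVec (x t).ofLp +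
        (NormedSpace.exp (t • -A)).mulVec ((A + ε • P t).mulVec (x t).ofLp) =
        ε • (conjPerturbation A P t).mulVec
          ((NormedSpace.exp (-(t • A))).mulVec (x t).ofLp) := by
      rw [Matrix.mulVec_mulVec, Matrix.mulVec_mulVec, ← Matrix.add_mulVec, ← Matrix.smul_mulVec,
        conjPerturbation, Matrix.mul_assoc, Matrix.exp_mul_exp_neg, smul_neg, Matrix.mul_add,
        Matrix.mul_neg, Matrix.mul_one, Matrix.mul_smul, neg_add_cancel_left]
    have hi := congrFun hvec i
    simp only [Pi.add_apply, Pi.smul_apply, smul_eq_mul] at hi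
    rw [← hi, Finset.sum_add_distrib]
    rfl

end IsSolutionOn

theorem EuclideanSpace.norm_le_sum_abs {n : ℕ} (v : EuclideanSpace ℝ (Fin n)) :
    ‖v‖ ≤ ∑ i, |v i| := by
  rw [EuclideanSpace.norm_eq]
  refine Real.sqrt_le_iff.2 ⟨Finset.sum_nonneg fun _ _ => abs_nonneg _, ?_⟩
  simp only [Real.norm_eq_abs]
  exact Finset.sum_sq_le_sq_sum_of_nonneg fun i _ => abs_nonneg _

theorem corollary14 {n : ℕ} (A : Matrix (Fin n) (Fin n) ℝ) (ω : ℝ) (hω : 0 < ω)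
    (P : ℝ → Matrix (Fin n) (Fin n) ℝ) (hP : IsPeriodicL2 ω P)
    (hmean : ∀ i j, ∫ t in (0 : ℝ)..(2 * Real.pi / ω), P t i j = 0)
    (hdiag : IsComplexDiagonalizable A)
    (hre : ∀ z ∈ complexEigenvalues A, ∀ w ∈ complexEigenvalues A, z.re = w.re)
    (hres : ∀ z ∈ complexEigenvalues A, ∀ w ∈ complexEigenvalues A, ∀ l : ℤ, l ≠ 0 →
      |z.im - w.im| ≠ l * ω ∧ |z.im + w.im| ≠ l * ω) :
    IsEffectiveMatrix A P 0 ∧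
    ∀ K > (0 : ℝ), ∀ ε₀ > (0 : ℝ), ∃ C > (0 : ℝ), ∀ ε : ℝ, 0 < ε → ε ≤ ε₀ →
      ∀ x : ℝ → EuclideanSpace ℝ (Fin n),
        IsSolutionOn A ε P (fun _ => 0) (K / ε) x →
        ∃ E : ℝ → EuclideanSpace ℝ (Fin n), ∀ t ∈ Set.Icc 0 (K / ε),
          x t = Matrix.toEuclideanLin (NormedSpace.exp (t • A)) (x 0 + E t) ∧
          ‖E t‖ ≤ C * ε * Real.exp (ε ^ 2 * C * t) * ‖x 0‖ := by
  have hbdd := exists_bound_integral_conjPerturbation hω hP hmean hdiag hre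
    fun z hz w hw l hl => (hres z hz w hw l hl).1
  refine ⟨isEffectiveMatrix_zero_of_bounded hbdd, fun K hK ε₀ hε₀ => ?_⟩
  choose r hr using hbdd
  obtain ⟨a, ha, hqa⟩ := exists_bound_integral_sum_abs_conjPerturbation hω hP hdiag hre
  have hr0 : 0 ≤ ∑ i, ∑ j, r i j := Finset.sum_nonneg fun i _ => Finset.sum_nonneg fun j _ =>
    (abs_nonneg _).trans (hr i j 0)
  -- `K + ε₀` bounds `ε (T + 1)` for `T = K / ε`; the factor `n` converts the `ℓ¹` norm of `x 0` to
  -- the Euclidean one.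
  set D := (∑ i, ∑ j, r i j) * (1 + a * (K + ε₀)) * (Real.exp (a * (K + ε₀)) * n) with hD
  have hD0 : 0 ≤ D := by positivity
  -- `D` may vanish, and the constant must be positive.
  refine ⟨D + 1, by positivity, fun ε hε hεε₀ x hx => ?_⟩
  have hT : 0 ≤ K / ε := by positivity
  have hεT : ε * (K / ε + 1) ≤ K + ε₀ := by
    rw [mul_add, mul_div_cancel₀ _ hε.ne']; linarith
  let y : ℝ → Fin n → ℝ := fun t => (NormedSpace.exp (-(t • A))).mulVec (x t).ofLp
  have hy0 : y 0 = (x 0).ofLp := by simp [y]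
  have hmain := sum_abs_sub_initial_le_of_bounded_primitive (y := y) hε hT
    (intervalIntegrable_conjPerturbation_apply hω A hP)
    (fun i => hx.isPrimitiveOn_exp_neg_mulVec hT i) hr ha hqa
  -- The error is the displacement in the moving frame.
  refine ⟨fun t => WithLp.toLp 2 (y t) - x 0, fun t ht => ⟨?_, ?_⟩⟩
  · rw [add_sub_cancel, Matrix.toLpLin_toLp]
    simp only [y]
    rw [Matrix.toLin'_apply, Matrix.mulVec_mulVec, Matrix.exp_mul_exp_neg, Matrix.one_mulVec]
  · have hx0 : ∑ i, |y 0 i| ≤ n * ‖x 0‖ := by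
      rw [hy0]
      calc ∑ i, |x 0 i| ≤ ∑ _i : Fin n, ‖x 0‖ :=
            Finset.sum_le_sum fun i _ => PiLp.norm_apply_le (x 0) i
        _ = n * ‖x 0‖ := by simp
    -- On `t ≤ K / ε` all growth is already contained in `D`, so the exponential factor only has to
    -- be at least 1.
    have hexp : 1 ≤ Real.exp (ε ^ 2 * (D + 1) * t) :=
      Real.one_le_exp (mul_nonneg (by positivity) ht.1)
    calc ‖WithLp.toLp 2 (y t) - x 0‖ ≤ ∑ i, |y t i - y 0 i| := by
          rw [hy0]; exact EuclideanSpace.norm_le_sum_abs _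
      _ ≤ _ := hmain t ht
      _ ≤ ε * (∑ i, ∑ j, r i j) * (1 + a * (K + ε₀)) *
          (Real.exp (a * (K + ε₀)) * (n * ‖x 0‖)) := by gcongr
      _ = D * ε * 1 * ‖x 0‖ := by rw [hD]; ring
      _ ≤ (D + 1) * ε * Real.exp (ε ^ 2 * (D + 1) * t) * ‖x 0‖ := by
          gcongr
          linarith
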